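/- Use the Poincaré ball model of hyperbolic space, $\mathbb{H}^3=\{x\in\mathbb{R}^3:|x|<1\}$ with the metric $\left(\frac{2}{1-|x|^2}\right)^2\delta$, where $\delta$ is the Euclidean metric, and let $\rho(x)=\frac{1+|x|^2}{1-|x|^2}$; equivalently, $\rho=\cosh r$, where $r$ is the hyperbolic distance to the origin. Let $\omega_2=4\pi$ be the area of the unit sphere $\mathbb{S}^2\subset\mathbb{R}^3$. **Theorem.** There exists a smooth closed surface $\Gamma$ in $\mathbb{H}^3$, namely a smoothly embedded $2$-sphere, which is horospherically convex (all of its principal curvatures with respect to the outward unit normal are greater than or equal to $1$) and satisfies $$ \int_\Gamma \rho\, d\Gamma \;<\; \omega_2\left[\left(\frac{|\Gamma|}{\omega_2}\right)^{3}+\left(\frac{|\Gamma|}{\omega_2}\right)^{2}\right]^{1/2}, $$ where $d\Gamma$ and $|\Gamma|$ are the area element and the area of $\Gamma$ induced by the hyperbolic metric. -/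

import Mathlib

open Set Filter Topology MeasureTheory
open scoped ContDiff RealInnerProductSpace

noncomputable section

namespace PoincareBall

/-- The ambient Euclidean space `ℝⁿ` of the Poincaré ball model `{x : ‖x‖ < 1}` of `ℍⁿ`. -/
abbrev E (n : ℕ) : Type := EuclideanSpace ℝ (Fin n)

variable {n : ℕ}

/-- The conformal factor `φ(y) = 2 / (1 - ‖y‖²)`. -/
def conformalFactor (y : E n) : ℝ := 2 / (1 - ‖y‖ ^ 2)

/-- The hyperbolic metric `φ² δ` at the point `y`. -/
def metric (y a b : E n) : ℝ := conformalFactor y ^ 2 * ⟪a, b⟫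

/-- The weight `ρ = cosh r`, where `r` is the hyperbolic distance to the origin. -/
def rho (y : E n) : ℝ := (1 + ‖y‖ ^ 2) / (1 - ‖y‖ ^ 2)

/-- The Christoffel symbols of the hyperbolic metric: for constant vector fields `a`, `b`,
`D_a b = christoffel y a b` at the point `y`. -/
def christoffel (y a b : E n) : E n :=
  conformalFactor y • (⟪y, a⟫ • b + ⟪y, b⟫ • a - ⟪a, b⟫ • y)

/-- The connection is torsion-free. -/
theorem christoffel_symm (y a b : E n) : christoffel y a b = christoffel y b a := by
  unfold christoffel
  rw [real_inner_comm b a, add_comm]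

/-- The connection is compatible with the metric; together with `christoffel_symm` this says that
it is the Levi-Civita connection. -/
theorem hasFDerivAt_metric (y a b c : E n) (hy : ‖y‖ < 1) :
    DifferentiableAt ℝ (fun z => metric z a b) y ∧
    fderiv ℝ (fun z => metric z a b) y c =
      metric y (christoffel y c a) b + metric y a (christoffel y c b) := by
  have h0 : (1 : ℝ) - ‖y‖ ^ 2 ≠ 0 := by nlinarith [norm_nonneg y]
  have h1 : HasFDerivAt (fun z : E n => (1 : ℝ) - ‖z‖ ^ 2) (-(2 • innerSL ℝ y)) y :=
    (hasStrictFDerivAt_norm_sq y).hasFDerivAt.const_sub 1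
  have h2 := ((((hasDerivAt_inv h0).comp_hasFDerivAt y h1).const_mul 2).pow 2).mul_const ⟪a, b⟫
  have h3 : (fun z : E n => metric z a b) =
      fun z : E n => (2 * (Inv.inv ∘ fun z : E n => (1 : ℝ) - ‖z‖ ^ 2) z) ^ 2 * ⟪a, b⟫ := by
    funext z
    simp [metric, conformalFactor, div_eq_mul_inv]
  rw [h3]
  refine ⟨h2.differentiableAt, ?_⟩
  rw [h2.fderiv]
  simp only [metric, christoffel, conformalFactor, inner_smul_left, inner_smul_right,
    inner_add_left, inner_add_right, inner_sub_left, inner_sub_right]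
  simp [real_inner_comm]
  field_simp
  ring

/-- The tangent space at `x` of the unit sphere `S^{n-1} ⊂ ℝⁿ`. -/
abbrev sphereTangent (x : E n) : Submodule ℝ (E n) := (ℝ ∙ x)ᗮ

/-- A closed hypersurface of `ℍⁿ` of the type of the sphere: a smooth embedding of the unit sphere
`S^{n-1}` into the Poincaré ball. The embedding is given as a map on `ℝⁿ` that is smooth at the
points of the sphere; its values off the sphere play no role. -/
structure EmbeddedSphere (n : ℕ) where
  /-- the embedding -/
  toFun : E n → E n
  smooth : ∀ x ∈ Metric.sphere (0 : E n) 1, ContDiffAt ℝ ∞ toFun x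
  norm_lt_one : ∀ x ∈ Metric.sphere (0 : E n) 1, ‖toFun x‖ < 1
  injOn : InjOn toFun (Metric.sphere (0 : E n) 1)
  immersion : ∀ x ∈ Metric.sphere (0 : E n) 1, ∀ v ∈ sphereTangent x,
    fderiv ℝ toFun x v = 0 → v = 0

namespace EmbeddedSphere

variable (Γ : EmbeddedSphere n)

/-- The hypersurface as a set of points. -/
def image : Set (E n) := Γ.toFun '' Metric.sphere (0 : E n) 1

/-- The differential of the embedding along the sphere, at the point `x`. -/
def differential (x : E n) : sphereTangent x →ₗ[ℝ] E n :=
  (fderiv ℝ Γ.toFun x : E n →ₗ[ℝ] E n).domRestrict (sphereTangent x)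

/-- The exterior of the hypersurface: the points of its complement whose connected component is
unbounded. -/
def exterior : Set (E n) :=
  {y | y ∉ Γ.image ∧ ¬ Bornology.IsBounded (connectedComponentIn Γ.imageᶜ y)}

/-- `ξ`, a vector field along the embedding, is the outward unit normal of the hypersurface with
respect to the hyperbolic metric. -/
structure IsOutwardUnitNormal (ξ : E n → E n) : Prop where
  smooth : ∀ x ∈ Metric.sphere (0 : E n) 1, ContDiffAt ℝ ∞ ξ x
  unit : ∀ x ∈ Metric.sphere (0 : E n) 1, metric (Γ.toFun x) (ξ x) (ξ x) = 1
  normal : ∀ x ∈ Metric.sphere (0 : E n) 1, ∀ v : sphereTangent x,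
    metric (Γ.toFun x) (ξ x) (Γ.differential x v) = 0
  outward : ∀ x ∈ Metric.sphere (0 : E n) 1,
    ∀ᶠ t : ℝ in 𝓝[>] 0, Γ.toFun x + t • ξ x ∈ Γ.exterior

/-- The Levi-Civita covariant derivative `D_v ξ` of a vector field `ξ` along the embedding, in the
direction of the tangent vector `v` of the sphere at `x`. -/
def covariantDeriv (ξ : E n → E n) (x : E n) (v : sphereTangent x) : E n :=
  fderiv ℝ ξ x v + christoffel (Γ.toFun x) (Γ.differential x v) (ξ x)

/-- `κ` is a principal curvature at `x` with respect to the unit normal `ξ`: an eigenvalue of the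
shape operator `dΓ(v) ↦ D_v ξ`. For the outward normal, a geodesic sphere of radius `r` has
principal curvatures `coth r`. -/
def IsPrincipalCurvature (ξ : E n → E n) (x : E n) (κ : ℝ) : Prop :=
  ∃ v : sphereTangent x, v ≠ 0 ∧ Γ.covariantDeriv ξ x v = κ • Γ.differential x v

/-- Horospherical convexity: all principal curvatures, with respect to the outward unit normal,
are at least `1`. -/
def HorosphericallyConvex : Prop :=
  ∃ ξ : E n → E n, Γ.IsOutwardUnitNormal ξ ∧
    ∀ x ∈ Metric.sphere (0 : E n) 1, ∀ κ : ℝ, Γ.IsPrincipalCurvature ξ x κ → 1 ≤ κ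

/-- The density, with respect to the area element of the round unit sphere, of the area element
that the hyperbolic metric induces on the hypersurface: the square root of the Gram determinant of
the image of an orthonormal basis of the tangent space of the sphere. -/
def areaDensity (x : E n) : ℝ :=
  Real.sqrt (Matrix.det (Matrix.of fun i j =>
    metric (Γ.toFun x)
      (Γ.differential x (stdOrthonormalBasis ℝ (sphereTangent x) i))
      (Γ.differential x (stdOrthonormalBasis ℝ (sphereTangent x) j))))

/-- The integral over the hypersurface of a function with respect to its hyperbolic area. -/
def surfaceIntegral (f : E n → ℝ) : ℝ :=
  ∫ x : Metric.sphere (0 : E n) 1, f (Γ.toFun x) * Γ.areaDensity x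
    ∂(volume : Measure (E n)).toSphere

/-- The hyperbolic area `|Γ|`. -/
def area : ℝ := Γ.surfaceIntegral fun _ => 1

end EmbeddedSphere

/-- The area `ω_{n-1}` of the round unit sphere `S^{n-1} ⊂ ℝⁿ`. -/
def unitSphereArea (n : ℕ) : ℝ := (volume : Measure (E n)).toSphere.real univ

end PoincareBall

end

noncomputable section

namespace PoincareBall

/-! Geodesic spheres centred at the origin give equality: with `cosh r = c` the area is `(c² - 1)
ω₂` and the integral of `ρ` is `c (c² - 1) ω₂`. The counterexample perturbs such a sphere to second
order, taking `cosh r = c + ε u` with `c = 11/10`, `ε = 1/1000` and `u = x₀x₁x₂`, a spherical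
harmonic of degree `3`.

The area density over the unit sphere is `√((cosh² r - 1)² + ε² |∇u|²)`, which is `‖normalField‖`.
Put `W = ω₂`, `M = ∫ u²`, and let `B` be the integral of `densityExcess`, the part of the density
due to the gradient. Odd powers of `u` integrate to zero, so the area is `A = (c² - 1) W + ε² M +
B`, and the integral of `ρ` is at most `c A + 2c ε² M + ε B`. To leading order, with `B ≈ ε² ∫ |∇u|²
/ (2 (c² - 1))` and `∫ |∇u|² = k (k + 1) M` for degree `k`, the strict inequality becomes `6c² + 2 <
k (k + 1)`. Degree `2` fails for every `c > 1`; degree `3` works when `c² < 5/3`, hence for `c =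
11/10`.

The reference sphere has principal curvatures `coth r > 2`, so the small perturbation leaves them
above `1`. The main ingredients are `one_le_principalCurvature`, `areaDensity_surface`,
`integral_norm_sq_cubicTangentGrad` and `lt_mul_rpow_of_density_bounds`. -/

/-- The spherical harmonic `x₀ x₁ x₂`. -/
def cubic (x : E 3) : ℝ := x 0 * x 1 * x 2

/-- The Euclidean gradient of `cubic`. -/
def cubicGrad (x : E 3) : E 3 := !₂[x 1 * x 2, x 0 * x 2, x 0 * x 1]

/-- On the unit sphere, the spherical gradient of `cubic`. -/
def cubicTangentGrad (x : E 3) : E 3 := cubicGrad x - (3 * cubic x) • x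

/-- The value of `cosh r` at the point of the surface in the direction `x`. -/
def height (x : E 3) : ℝ := 11 / 10 + cubic x / 1000

/-- The Euclidean distance to the origin of the point of the surface in the direction `x`. -/
def radius (x : E 3) : ℝ := √(height x ^ 2 - 1) / (height x + 1)

/-- An outward normal field of the surface; its length is the hyperbolic area density. -/
def normalField (x : E 3) : E 3 :=
  (height x ^ 2 - 1) • x - (1 / 1000 : ℝ) • cubicTangentGrad x

/-! ### The cubic harmonic and pointwise bounds on the sphere -/

theorem inner_eq_sum_three (x y : E 3) : ⟪x, y⟫ = x 0 * y 0 + x 1 * y 1 + x 2 * y 2 := by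
  simp [PiLp.inner_apply, Fin.sum_univ_three, mul_comm]

theorem norm_sq_eq_sum_three (x : E 3) : ‖x‖ ^ 2 = x 0 ^ 2 + x 1 ^ 2 + x 2 ^ 2 := by
  rw [EuclideanSpace.real_norm_sq_eq, Fin.sum_univ_three]

theorem sum_sq_of_mem_sphere {x : E 3} (hx : x ∈ Metric.sphere (0 : E 3) 1) :
    x 0 ^ 2 + x 1 ^ 2 + x 2 ^ 2 = 1 := by
  rw [← norm_sq_eq_sum_three, mem_sphere_zero_iff_norm.1 hx, one_pow]

theorem abs_cubic_le (x : E 3) : |cubic x| ≤ ‖x‖ ^ 3 := by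
  have h (i : Fin 3) : |x i| ≤ ‖x‖ := by simpa using PiLp.norm_apply_le x i
  rw [cubic, abs_mul, abs_mul, pow_succ, sq]
  gcongr <;> exact h _

theorem abs_cubic_le_one {x : E 3} (hx : x ∈ Metric.sphere (0 : E 3) 1) : |cubic x| ≤ 1 := by
  simpa [mem_sphere_zero_iff_norm.1 hx] using abs_cubic_le x

theorem cubic_smul (t : ℝ) (x : E 3) : cubic (t • x) = t ^ 3 * cubic x := by
  simp [cubic]; ring

theorem cubicGrad_smul (t : ℝ) (x : E 3) : cubicGrad (t • x) = t ^ 2 • cubicGrad x := by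
  ext i; fin_cases i <;> simp [cubicGrad] <;> ring

theorem contDiff_cubic : ContDiff ℝ ∞ cubic := by
  unfold cubic; fun_prop

theorem contDiff_cubicGrad : ContDiff ℝ ∞ cubicGrad := by
  rw [contDiff_euclidean]
  intro i
  fin_cases i <;> simp [cubicGrad] <;> fun_prop

theorem contDiff_height : ContDiff ℝ ∞ height :=
  contDiff_const.add (contDiff_cubic.div_const _)

theorem contDiff_cubicTangentGrad : ContDiff ℝ ∞ cubicTangentGrad :=
  contDiff_cubicGrad.sub ((contDiff_const.mul contDiff_cubic).smul contDiff_id)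

theorem contDiff_normalField : ContDiff ℝ ∞ normalField :=
  (((contDiff_height.pow 2).sub contDiff_const).smul contDiff_id).sub
    (contDiff_cubicTangentGrad.const_smul (1 / 1000 : ℝ))

theorem hasFDerivAt_cubic (x : E 3) : HasFDerivAt cubic (innerSL ℝ (cubicGrad x)) x := by
  have h (i : Fin 3) : HasFDerivAt (fun y : E 3 => y i) (EuclideanSpace.proj (𝕜 := ℝ) i) x :=
    (EuclideanSpace.proj (𝕜 := ℝ) i).hasFDerivAt
  refine (((h 0).fun_mul (h 1)).fun_mul (h 2)).congr_fderiv (ContinuousLinearMap.ext fun v => ?_)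
  rw [innerSL_apply_apply]
  rw [inner_eq_sum_three]
  simp [cubicGrad]
  ring

theorem fderiv_cubicGrad (x v : E 3) : fderiv ℝ cubicGrad x v =
    !₂[v 1 * x 2 + x 1 * v 2, v 0 * x 2 + x 0 * v 2, v 0 * x 1 + x 0 * v 1] := by
  have h (i : Fin 3) : HasFDerivAt (fun y : E 3 => y i) (EuclideanSpace.proj (𝕜 := ℝ) i) x :=
    (EuclideanSpace.proj (𝕜 := ℝ) i).hasFDerivAt
  have hd : DifferentiableAt ℝ cubicGrad x := contDiff_cubicGrad.differentiable (by simp) x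
  have hc (i : Fin 3) : fderiv ℝ cubicGrad x v i = fderiv ℝ (fun y => cubicGrad y i) x v := by
    have := ((EuclideanSpace.proj (𝕜 := ℝ) i).hasFDerivAt.comp x hd.hasFDerivAt).fderiv
    exact (DFunLike.congr_fun this v).symm
  ext i
  rw [hc]
  fin_cases i
  · simp [cubicGrad, ((h 1).fun_mul (h 2)).fderiv]; ring
  · simp [cubicGrad, ((h 0).fun_mul (h 2)).fderiv]; ring
  · simp [cubicGrad, ((h 0).fun_mul (h 1)).fderiv]; ring

theorem inner_cubicGrad_self (x : E 3) : ⟪x, cubicGrad x⟫ = 3 * cubic x := by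
  simp [inner_eq_sum_three, cubicGrad, cubic]; ring

section Sphere

variable {x : E 3} (hx : x ∈ Metric.sphere (0 : E 3) 1)
include hx

theorem inner_cubicTangentGrad_self : ⟪x, cubicTangentGrad x⟫ = 0 := by
  rw [cubicTangentGrad, inner_sub_right, inner_cubicGrad_self, real_inner_smul_right,
    real_inner_self_eq_norm_sq, mem_sphere_zero_iff_norm.1 hx]
  ring

theorem norm_sq_cubicTangentGrad :
    ‖cubicTangentGrad x‖ ^ 2 = ‖cubicGrad x‖ ^ 2 - 9 * cubic x ^ 2 := by
  rw [cubicTangentGrad, norm_sub_sq_real, real_inner_comm, real_inner_smul_left,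
    inner_cubicGrad_self, norm_smul, mul_pow, mem_sphere_zero_iff_norm.1 hx, Real.norm_eq_abs,
    sq_abs]
  ring

theorem norm_sq_cubicTangentGrad_le_one : ‖cubicTangentGrad x‖ ^ 2 ≤ 1 := by
  have h := sum_sq_of_mem_sphere hx
  -- Writing the bound `1` as a quartic form makes the comparison with `‖cubicGrad x‖ ^ 2`
  -- coefficientwise.
  have h1 : 1 = (x 0 ^ 2 + x 1 ^ 2 + x 2 ^ 2) ^ 2 := by rw [h, one_pow]
  rw [norm_sq_cubicTangentGrad hx, norm_sq_eq_sum_three, h1]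
  simp [cubicGrad, cubic]
  nlinarith [sq_nonneg (x 0 * x 1), sq_nonneg (x 0 * x 2), sq_nonneg (x 2 * x 1),
    sq_nonneg (x 0 ^ 2), sq_nonneg (x 1 ^ 2), sq_nonneg (x 2 ^ 2), sq_nonneg (x 0 * x 1 * x 2)]

theorem height_mem_Icc : height x ∈ Icc (1.099 : ℝ) 1.101 := by
  have := abs_le.1 (abs_cubic_le_one hx)
  constructor <;> unfold height <;> norm_num <;> linarith

theorem height_sq_sub_one_mem_Icc : height x ^ 2 - 1 ∈ Icc (0.2078 : ℝ) 0.2123 := by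
  obtain ⟨h1, h2⟩ := height_mem_Icc hx
  norm_num at h1 h2 ⊢
  constructor <;> nlinarith

theorem height_sq_sub_one_pos : 0 < height x ^ 2 - 1 :=
  lt_of_lt_of_le (by norm_num) (height_sq_sub_one_mem_Icc hx).1

theorem height_add_one_pos : 0 < height x + 1 :=
  lt_of_lt_of_le (by norm_num) (add_le_add_left (height_mem_Icc hx).1 1)

theorem radius_pos : 0 < radius x :=
  div_pos (Real.sqrt_pos.2 (height_sq_sub_one_pos hx)) (height_add_one_pos hx)

theorem radius_sq : radius x ^ 2 = (height x - 1) / (height x + 1) := by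
  have := height_add_one_pos hx
  rw [radius, div_pow, Real.sq_sqrt (height_sq_sub_one_pos hx).le]
  field_simp
  ring

theorem radius_lt_one : radius x < 1 := by
  have := height_add_one_pos hx
  refine lt_of_pow_lt_pow_left₀ 2 zero_le_one ?_
  rw [radius_sq hx, one_pow, div_lt_one this]
  linarith

theorem inner_self_normalField : ⟪x, normalField x⟫ = height x ^ 2 - 1 := by
  rw [normalField, inner_sub_right, real_inner_smul_right, real_inner_smul_right,
    inner_cubicTangentGrad_self hx, real_inner_self_eq_norm_sq, mem_sphere_zero_iff_norm.1 hx]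
  ring

theorem norm_sq_normalField : ‖normalField x‖ ^ 2 =
    (height x ^ 2 - 1) ^ 2 + (1 / 1000) ^ 2 * ‖cubicTangentGrad x‖ ^ 2 := by
  rw [normalField, norm_sub_sq_real, real_inner_smul_left, real_inner_smul_right,
    inner_cubicTangentGrad_self hx, norm_smul, norm_smul, mul_pow, mul_pow,
    mem_sphere_zero_iff_norm.1 hx, Real.norm_eq_abs, sq_abs]
  norm_num

theorem norm_normalField_pos : 0 < ‖normalField x‖ := by
  have h := height_sq_sub_one_pos hx
  rw [norm_pos_iff]
  intro h0
  have := inner_self_normalField hx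
  simp [h0] at this
  linarith

theorem height_sq_sub_one_le_norm_normalField : height x ^ 2 - 1 ≤ ‖normalField x‖ := by
  refine le_of_sq_le_sq ?_ (norm_nonneg _)
  rw [norm_sq_normalField hx]
  linarith [show 0 ≤ (1 / 1000 : ℝ) ^ 2 * ‖cubicTangentGrad x‖ ^ 2 by positivity]

theorem norm_normalField_le : ‖normalField x‖ ≤ 0.2125 := by
  refine le_of_sq_le_sq ?_ (by norm_num)
  rw [norm_sq_normalField hx]
  have h1 := height_sq_sub_one_mem_Icc hx
  have h2 := norm_sq_cubicTangentGrad_le_one hx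
  have h3 : (height x ^ 2 - 1) ^ 2 ≤ (0.2123 : ℝ) ^ 2 :=
    pow_le_pow_left₀ (height_sq_sub_one_pos hx).le h1.2 2
  norm_num at h3 ⊢
  linarith

end Sphere

/-! ### Differential, normal and second fundamental form of the radial graph -/

/-- The radial graph of `radius`. -/
def radialGraph (x : E 3) : E 3 := radius x • x

/-- A positive multiple of the image of `v` under the differential of `radialGraph`. -/
def tangentVector (x v : E 3) : E 3 :=
  (height x ^ 2 - 1) • v + (⟪cubicGrad x, v⟫ / 1000) • x

/-- The outward unit normal of the surface. -/
def unitNormal (x : E 3) : E 3 := ((height x + 1) * ‖normalField x‖)⁻¹ • normalField x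

theorem hasFDerivAt_height (x : E 3) :
    HasFDerivAt height ((1 / 1000 : ℝ) • innerSL ℝ (cubicGrad x)) x := by
  have h : height = fun y => 11 / 10 + (1 / 1000 : ℝ) • cubic y := by
    funext y; simp [height]; ring
  rw [h]
  exact ((hasFDerivAt_cubic x).const_smul (1 / 1000 : ℝ)).const_add (11 / 10)

/-- For `t = cosh r` the function is `tanh (r / 2)`, the Euclidean radius; its logarithmic
derivative in `t` is `1 / sinh² r`. -/
theorem hasDerivAt_sqrt_div {c : ℝ} (hc : 1 < c) :
    HasDerivAt (fun t : ℝ => √(t ^ 2 - 1) / (t + 1)) (√(c ^ 2 - 1) / (c + 1) / (c ^ 2 - 1)) c := by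
  have h0 : 0 < c ^ 2 - 1 := by nlinarith
  have h1 : HasDerivAt (fun t : ℝ => t ^ 2 - 1) (2 * c) c := by
    simpa using (hasDerivAt_pow 2 c).sub_const 1
  have h2 := (h1.sqrt h0.ne').div ((hasDerivAt_id c).add_const 1) (by simp; linarith)
  refine h2.congr_deriv ?_
  have hs : 0 < √(c ^ 2 - 1) := Real.sqrt_pos.2 h0
  have hs2 : √(c ^ 2 - 1) ^ 2 = c ^ 2 - 1 := Real.sq_sqrt h0.le
  have hc1 : 0 < c + 1 := by linarith
  simp only [id]
  field_simp
  rw [hs2]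
  ring

theorem fderiv_cubicTangentGrad (x v : E 3) : fderiv ℝ cubicTangentGrad x v =
    fderiv ℝ cubicGrad x v - ((3 * cubic x) • v + (3 * ⟪cubicGrad x, v⟫) • x) := by
  have h1 : DifferentiableAt ℝ cubicGrad x := contDiff_cubicGrad.differentiable (by simp) x
  have h2 := h1.hasFDerivAt.sub (((hasFDerivAt_cubic x).const_mul 3).smul (hasFDerivAt_id x))
  have h3 : HasFDerivAt cubicTangentGrad _ x := h2
  rw [h3.fderiv]
  simp

theorem fderiv_normalField (x v : E 3) : fderiv ℝ normalField x v =
    (2 * height x * (⟪cubicGrad x, v⟫ / 1000)) • x + (height x ^ 2 - 1) • v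
      - (1 / 1000 : ℝ) • (fderiv ℝ cubicGrad x v
        - ((3 * cubic x) • v + (3 * ⟪cubicGrad x, v⟫) • x)) := by
  have h1 : DifferentiableAt ℝ cubicTangentGrad x :=
    contDiff_cubicTangentGrad.differentiable (by simp) x
  have h2 := ((((hasFDerivAt_height x).pow 2).sub_const 1).smul (hasFDerivAt_id x)).sub
    (h1.hasFDerivAt.const_smul (1 / 1000 : ℝ))
  have h3 : HasFDerivAt normalField _ x := h2
  rw [h3.fderiv]
  simp [fderiv_cubicTangentGrad]
  rw [add_comm]
  congr 2
  ring

theorem inner_fderiv_cubicGrad (x v : E 3) :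
    ⟪x, fderiv ℝ cubicGrad x v⟫ = 2 * ⟪cubicGrad x, v⟫ := by
  rw [fderiv_cubicGrad, inner_eq_sum_three, inner_eq_sum_three]
  simp [cubicGrad]
  ring

theorem inner_cubicTangentGrad_eq {x v : E 3} (hv : ⟪x, v⟫ = 0) :
    ⟪cubicTangentGrad x, v⟫ = ⟪cubicGrad x, v⟫ := by
  rw [cubicTangentGrad, inner_sub_left, real_inner_smul_left, hv]
  ring

section Sphere

variable {x : E 3} (hx : x ∈ Metric.sphere (0 : E 3) 1)
include hx

theorem one_lt_height : 1 < height x :=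
  lt_of_lt_of_le (by norm_num) (height_mem_Icc hx).1

theorem hasFDerivAt_radius : HasFDerivAt radius
    ((radius x / (height x ^ 2 - 1)) • (1 / 1000 : ℝ) • innerSL ℝ (cubicGrad x)) x :=
  (hasDerivAt_sqrt_div (one_lt_height hx)).comp_hasFDerivAt x (hasFDerivAt_height x)

theorem contDiffAt_radius : ContDiffAt ℝ ∞ radius x :=
  (((contDiff_height.contDiffAt.pow 2).sub contDiffAt_const).sqrt
    (height_sq_sub_one_pos hx).ne').div (contDiff_height.contDiffAt.add contDiffAt_const)
    (height_add_one_pos hx).ne'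

theorem contDiffAt_radialGraph : ContDiffAt ℝ ∞ radialGraph x :=
  (contDiffAt_radius hx).smul contDiffAt_id

theorem contDiffAt_unitNormal : ContDiffAt ℝ ∞ unitNormal x :=
  (((contDiff_height.contDiffAt.add contDiffAt_const).mul
    (contDiff_normalField.contDiffAt.norm ℝ (norm_pos_iff.1 (norm_normalField_pos hx)))).inv
    (mul_pos (height_add_one_pos hx) (norm_normalField_pos hx)).ne').smul
    contDiff_normalField.contDiffAt

theorem fderiv_radialGraph (v : E 3) : fderiv ℝ radialGraph x v =
    (radius x / (height x ^ 2 - 1)) • tangentVector x v := by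
  have h3 : HasFDerivAt radialGraph _ x := (hasFDerivAt_radius hx).smul (hasFDerivAt_id x)
  have := height_sq_sub_one_pos hx
  rw [h3.fderiv, tangentVector, smul_add, smul_smul, smul_smul, div_mul_cancel₀ _ this.ne']
  simp [smul_smul, div_eq_mul_inv, mul_assoc, mul_comm, mul_left_comm]

theorem norm_radialGraph : ‖radialGraph x‖ = radius x := by
  rw [radialGraph, norm_smul, mem_sphere_zero_iff_norm.1 hx, mul_one,
    Real.norm_of_nonneg (radius_pos hx).le]

theorem conformalFactor_radialGraph : conformalFactor (radialGraph x) = height x + 1 := by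
  have := height_add_one_pos hx
  rw [conformalFactor, norm_radialGraph hx, radius_sq hx]
  field_simp
  ring

theorem rho_radialGraph : rho (radialGraph x) = height x := by
  have := height_add_one_pos hx
  rw [rho, norm_radialGraph hx, radius_sq hx]
  field_simp
  ring

theorem height_add_one_mul_radius_sq :
    (height x + 1) ^ 2 * radius x ^ 2 = height x ^ 2 - 1 := by
  have := height_add_one_pos hx
  rw [radius_sq hx]
  field_simp
  ring

variable {v : E 3} (hv : ⟪x, v⟫ = 0)
include hv

theorem inner_normalField_tangentVector : ⟪normalField x, tangentVector x v⟫ = 0 := by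
  have h1 : ⟪normalField x, v⟫ = - (⟪cubicGrad x, v⟫ / 1000) := by
    rw [normalField, inner_sub_left, real_inner_smul_left, real_inner_smul_left, hv,
      inner_cubicTangentGrad_eq hv]
    ring
  rw [tangentVector, inner_add_right, real_inner_smul_right, real_inner_smul_right, h1,
    real_inner_comm x (normalField x), inner_self_normalField hx]
  ring

theorem inner_cubicGrad_sq_le : ⟪cubicGrad x, v⟫ ^ 2 ≤ ‖v‖ ^ 2 := by
  have h := norm_sq_cubicTangentGrad_le_one hx
  rw [← inner_cubicTangentGrad_eq hv]
  calc _ ≤ (‖cubicTangentGrad x‖ * ‖v‖) ^ 2 :=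
        sq_le_sq.2 ((abs_real_inner_le_norm _ _).trans (le_abs_self _))
    _ ≤ 1 * ‖v‖ ^ 2 := by rw [mul_pow]; gcongr
    _ = _ := one_mul _

theorem inner_tangentVector {w : E 3} : ⟪tangentVector x v, tangentVector x w⟫ =
    (height x ^ 2 - 1) ^ 2 * ⟪v, w⟫ + (height x ^ 2 - 1) * (⟪cubicGrad x, v⟫ / 1000) * ⟪x, w⟫
      + ⟪cubicGrad x, v⟫ / 1000 * (⟪cubicGrad x, w⟫ / 1000) := by
  simp only [tangentVector, inner_add_left, inner_add_right, real_inner_smul_left,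
    real_inner_smul_right, real_inner_self_eq_norm_sq, mem_sphere_zero_iff_norm.1 hx,
    real_inner_comm x v, hv]
  ring

theorem norm_sq_tangentVector_le :
    ‖tangentVector x v‖ ^ 2 ≤ ((height x ^ 2 - 1) ^ 2 + (1 / 1000) ^ 2) * ‖v‖ ^ 2 := by
  rw [← real_inner_self_eq_norm_sq, inner_tangentVector hx hv, real_inner_self_eq_norm_sq, hv]
  nlinarith [inner_cubicGrad_sq_le hx hv]

theorem tangentVector_ne_zero (hv0 : v ≠ 0) : tangentVector x v ≠ 0 := by
  intro h
  have h1 : ⟪v, tangentVector x v⟫ = (height x ^ 2 - 1) * ‖v‖ ^ 2 := by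
    rw [tangentVector, inner_add_right, real_inner_smul_right, real_inner_smul_right,
      real_inner_comm x v, hv, real_inner_self_eq_norm_sq]
    ring
  rw [h, inner_zero_right] at h1
  have h2 := height_sq_sub_one_pos hx
  have h3 : 0 < ‖v‖ := norm_pos_iff.2 hv0
  have : 0 < (height x ^ 2 - 1) * ‖v‖ ^ 2 := by positivity
  linarith

/-- Lower bound for the Euclidean second fundamental form, up to a positive scaling. The round
sphere supplies the main term; the loss `0.005` is `5/1000`, with `3` from `3 * cubic x` and `2`
from the Hessian of `cubic`. -/
theorem le_inner_fderiv_normalField :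
    (height x ^ 2 - 1) * (height x ^ 2 - 1 - 0.005) * ‖v‖ ^ 2 ≤
      ⟪fderiv ℝ normalField x v, tangentVector x v⟫ := by
  have hs := height_sq_sub_one_pos hx
  have hc := one_lt_height hx
  have hu := abs_le.1 (abs_cubic_le_one hx)
  have hH : ⟪fderiv ℝ cubicGrad x v, v⟫ ≤ 2 * ‖v‖ ^ 2 := by
    have hb (i : Fin 3) : |x i| ≤ 1 := by
      simpa [mem_sphere_zero_iff_norm.1 hx] using PiLp.norm_apply_le x i
    rw [fderiv_cubicGrad, inner_eq_sum_three, norm_sq_eq_sum_three]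
    simp
    have key (a b c : ℝ) (ha : |a| ≤ 1) : 2 * (a * (b * c)) ≤ b ^ 2 + c ^ 2 := by
      obtain ⟨h1, h2⟩ := abs_le.1 ha
      nlinarith [sq_nonneg (b - c), sq_nonneg (b + c)]
    linarith [key _ (v 1) (v 2) (hb 0), key _ (v 0) (v 2) (hb 1), key _ (v 0) (v 1) (hb 2)]
  have heq : ⟪fderiv ℝ normalField x v, tangentVector x v⟫ =
      (height x ^ 2 - 1) ^ 2 * ‖v‖ ^ 2 + (height x ^ 2 - 1) / 1000 *
        (3 * cubic x * ‖v‖ ^ 2 - ⟪fderiv ℝ cubicGrad x v, v⟫)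
      + (2 * height x + 1) * (⟪cubicGrad x, v⟫ / 1000) ^ 2 := by
    have h1 := inner_fderiv_cubicGrad x v
    rw [real_inner_comm] at h1
    rw [fderiv_normalField, tangentVector]
    simp only [inner_add_left, inner_add_right, inner_sub_left, real_inner_smul_left,
      real_inner_smul_right, real_inner_comm x v, hv, h1]
    simp only [real_inner_self_eq_norm_sq, mem_sphere_zero_iff_norm.1 hx]
    ring
  rw [heq]
  have h4 : 0 ≤ (2 * height x + 1) * (⟪cubicGrad x, v⟫ / 1000) ^ 2 := by positivity
  have h5 : -5 * ‖v‖ ^ 2 ≤ 3 * cubic x * ‖v‖ ^ 2 - ⟪fderiv ℝ cubicGrad x v, v⟫ := by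
    nlinarith [sq_nonneg ‖v‖]
  have h6 := mul_le_mul_of_nonneg_left h5 (div_nonneg hs.le (by norm_num : (0 : ℝ) ≤ 1000))
  linarith

end Sphere

/-- The surface `cosh r = height`. -/
def surface : EmbeddedSphere 3 where
  toFun := radialGraph
  smooth _ hx := contDiffAt_radialGraph hx
  norm_lt_one _ hx := (norm_radialGraph hx).trans_lt (radius_lt_one hx)
  injOn := by
    intro x hx y hy h
    have hr : radius x = radius y := by rw [← norm_radialGraph hx, h, norm_radialGraph hy]
    simp only [radialGraph] at h
    rw [← hr] at h
    exact smul_right_injective _ (radius_pos hx).ne' h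
  immersion := by
    intro x hx v hv h
    by_contra hv0
    rw [fderiv_radialGraph hx, smul_eq_zero] at h
    refine h.elim (div_pos (radius_pos hx) (height_sq_sub_one_pos hx)).ne' ?_
    exact tangentVector_ne_zero hx (Submodule.mem_orthogonal_singleton_iff_inner_right.1 hv) hv0

theorem surface_toFun (x : E 3) : surface.toFun x = radialGraph x := rfl

/-! ### The exterior of the surface -/

/-- A defining function of the surface, positive outside. -/
def defining (y : E 3) : ℝ :=
  ((1 + ‖y‖ ^ 2) - (1 - ‖y‖ ^ 2) * (11 / 10)) * ‖y‖ ^ 3 - (1 - ‖y‖ ^ 2) * (cubic y / 1000)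

theorem defining_radialGraph {x : E 3} (hx : x ∈ Metric.sphere (0 : E 3) 1) :
    defining (radialGraph x) = 0 := by
  have := height_add_one_pos hx
  have h : (1 + radius x ^ 2) - (1 - radius x ^ 2) * height x = 0 := by
    rw [radius_sq hx]
    field_simp
    ring
  rw [defining, norm_radialGraph hx, radialGraph, cubic_smul]
  rw [height] at h
  linear_combination radius x ^ 3 * h

/-- Apart from the factor `r ^ 3`, dilation by `r` adds to `defining y` a multiple of `r ^ 2 - 1`
that is nonnegative because `|cubic y| ≤ ‖y‖ ^ 3`. -/
theorem defining_smul_pos {y : E 3} (hy : 0 < defining y) {r : ℝ} (hr : 1 ≤ r) :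
    0 < defining (r • y) := by
  have hr0 : 0 < r := by linarith
  have h1 : 0 ≤ 21 / 10 * ‖y‖ ^ 3 + cubic y / 1000 := by
    have := abs_le.1 (abs_cubic_le y)
    have := pow_nonneg (norm_nonneg y) 3
    linarith
  have h2 : defining (r • y) =
      r ^ 3 * (defining y + (r ^ 2 - 1) * ‖y‖ ^ 2 * (21 / 10 * ‖y‖ ^ 3 + cubic y / 1000)) := by
    rw [defining, defining, cubic_smul, norm_smul, Real.norm_of_nonneg hr0.le]
    ring
  have h3 : 0 ≤ r ^ 2 - 1 := by nlinarith
  rw [h2]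
  positivity

/-- The ray from `y` away from the origin never meets the surface, so it lies in the component of
`y` and makes it unbounded. -/
theorem mem_exterior_of_defining_pos {y : E 3} (hy : 0 < defining y) : y ∈ surface.exterior := by
  have hsub : {z : E 3 | 0 < defining z} ⊆ surface.imageᶜ := by
    rintro z hz ⟨x, hx, rfl⟩
    rw [surface_toFun, mem_ofPred, defining_radialGraph hx] at hz
    exact lt_irrefl _ hz
  refine ⟨hsub hy, fun hb => ?_⟩
  have hy0 : y ≠ 0 := by
    rintro rfl
    simp [defining, cubic] at hy
  have hray : (fun r : ℝ => r • y) '' Ici 1 ⊆ connectedComponentIn surface.imageᶜ y := by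
    refine IsPreconnected.subset_connectedComponentIn ?_ ⟨1, by simp, one_smul _ _⟩ ?_
    · exact isPreconnected_Ici.image _ (by fun_prop)
    · rintro _ ⟨r, hr, rfl⟩
      exact hsub (defining_smul_pos hy hr)
  obtain ⟨C, hC⟩ := (hb.subset hray).exists_norm_le
  have hy1 : 0 < ‖y‖ := norm_pos_iff.2 hy0
  have h := hC ((1 + |C| / ‖y‖) • y) ⟨_, by simp; positivity, rfl⟩
  rw [norm_smul, Real.norm_of_nonneg (by positivity), add_mul, div_mul_cancel₀ _ hy1.ne'] at h
  linarith [le_abs_self C]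

theorem hasDerivAt_defining {y : E 3} (hy : y ≠ 0) (w : E 3) :
    HasDerivAt (fun t : ℝ => defining (y + t • w))
      (42 / 10 * ⟪y, w⟫ * ‖y‖ ^ 3
        + ((1 + ‖y‖ ^ 2) - (1 - ‖y‖ ^ 2) * (11 / 10)) * (3 * ‖y‖ * ⟪y, w⟫)
        + 2 * ⟪y, w⟫ * (cubic y / 1000) - (1 - ‖y‖ ^ 2) * (⟪cubicGrad y, w⟫ / 1000)) 0 := by
  have hn : 0 < ‖y‖ := norm_pos_iff.2 hy
  have hl : HasDerivAt (fun t : ℝ => y + t • w) w 0 := by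
    simpa using ((hasDerivAt_id (0 : ℝ)).smul_const w).const_add y
  have hsq : HasDerivAt (fun t : ℝ => ‖y + t • w‖ ^ 2) (2 * ⟪y, w⟫) 0 := by
    simpa using hl.norm_sq
  have hnorm : HasDerivAt (fun t : ℝ => ‖y + t • w‖) (⟪y, w⟫ / ‖y‖) 0 := by
    have h := hsq.sqrt (by simpa using hy)
    simp only [Real.sqrt_sq (norm_nonneg _), zero_smul, add_zero] at h
    refine h.congr_deriv ?_
    field_simp
  have hc : HasDerivAt (fun t : ℝ => cubic (y + t • w)) ⟪cubicGrad y, w⟫ 0 := by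
    have := (hasFDerivAt_cubic (y + (0 : ℝ) • w)).comp_hasDerivAt (0 : ℝ) hl
    simpa [Function.comp_def] using this
  have h := (((hsq.const_add 1).sub ((hsq.const_sub 1).mul_const (11 / 10))).mul
    (hnorm.pow 3)).sub ((hsq.const_sub 1).mul (hc.div_const 1000))
  refine h.congr_deriv ?_
  simp
  field_simp
  ring

/-- `defining` vanishes on the surface and has positive derivative along the normal, so it is
positive just beyond it. -/
theorem eventually_mem_exterior {x : E 3} (hx : x ∈ Metric.sphere (0 : E 3) 1) :
    ∀ᶠ t : ℝ in 𝓝[>] 0, radialGraph x + t • unitNormal x ∈ surface.exterior := by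
  have hr := radius_pos hx
  have hr1 := radius_lt_one hx
  have hh := height_add_one_pos hx
  have hs := height_sq_sub_one_pos hx
  have hN := norm_normalField_pos hx
  have hy : radialGraph x ≠ 0 := by
    rw [← norm_pos_iff, norm_radialGraph hx]; exact hr
  set e := ((height x + 1) * ‖normalField x‖)⁻¹ with he
  have he0 : 0 < e := by positivity
  have h1 : ⟪radialGraph x, unitNormal x⟫ = radius x * (e * (height x ^ 2 - 1)) := by
    rw [radialGraph, unitNormal, real_inner_smul_left, real_inner_smul_right,
      inner_self_normalField hx]
  have h2 : ⟪cubicGrad x, normalField x⟫ = 3 * cubic x * (height x ^ 2 - 1)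
      - ‖cubicTangentGrad x‖ ^ 2 / 1000 := by
    have h3 : cubicGrad x = cubicTangentGrad x + (3 * cubic x) • x := by
      simp [cubicTangentGrad]
    rw [h3, inner_add_left, real_inner_smul_left, inner_self_normalField hx, normalField,
      inner_sub_right, real_inner_smul_right, real_inner_smul_right,
      real_inner_comm, inner_cubicTangentGrad_self hx, real_inner_self_eq_norm_sq]
    ring
  have h3 : ⟪cubicGrad (radialGraph x), unitNormal x⟫ = radius x ^ 2 * (e *
      (3 * cubic x * (height x ^ 2 - 1) - ‖cubicTangentGrad x‖ ^ 2 / 1000)) := by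
    rw [radialGraph, unitNormal, cubicGrad_smul, real_inner_smul_left, real_inner_smul_right, h2]
  have hd := hasDerivAt_defining hy (unitNormal x)
  rw [h1, h3, norm_radialGraph hx, radialGraph, cubic_smul] at hd
  -- The equation of the surface. After this substitution the radial part of the gradient of `cubic`
  -- cancels from the derivative, leaving two terms of evident sign.
  have hk : (1 + radius x ^ 2) - (1 - radius x ^ 2) * (11 / 10) =
      (1 - radius x ^ 2) * (cubic x / 1000) := by
    have h : (1 + radius x ^ 2) - (1 - radius x ^ 2) * height x = 0 := by
      rw [radius_sq hx]
      field_simp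
      ring
    rw [height] at h
    linarith
  rw [hk] at hd
  have hpos : 0 < 2 * (height x + 1) * radius x ^ 4 * e * (height x ^ 2 - 1)
      + (1 - radius x ^ 2) * radius x ^ 2 * e * ‖cubicTangentGrad x‖ ^ 2 / 1000 ^ 2 := by
    have : 0 < 1 - radius x ^ 2 := by nlinarith
    positivity
  have hd' := hd.congr_deriv (g' := 2 * (height x + 1) * radius x ^ 4 * e * (height x ^ 2 - 1)
      + (1 - radius x ^ 2) * radius x ^ 2 * e * ‖cubicTangentGrad x‖ ^ 2 / 1000 ^ 2) (by
    have hu : height x + 1 = 21 / 10 + cubic x / 1000 := by rw [height]; ring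
    rw [hu]
    ring)
  have hev := (hasDerivAt_iff_tendsto_slope.1 hd').mono_left
    (nhdsWithin_mono (0 : ℝ) (fun t (ht : 0 < t) => ne_of_gt ht))
  filter_upwards [hev.eventually (lt_mem_nhds hpos), self_mem_nhdsWithin] with t ht ht0
  refine mem_exterior_of_defining_pos ?_
  have h0 : defining (radius x • x + (0 : ℝ) • unitNormal x) = 0 := by
    rw [zero_smul, add_zero]; exact defining_radialGraph hx
  rw [slope_def_field, h0, sub_zero, sub_zero] at ht
  exact (div_pos_iff_of_pos_right ht0).1 ht

/-! ### Outward normal and horospherical convexity -/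

theorem isOutwardUnitNormal_unitNormal : surface.IsOutwardUnitNormal unitNormal where
  smooth _ hx := contDiffAt_unitNormal hx
  unit x hx := by
    have hh := height_add_one_pos hx
    have hN := norm_normalField_pos hx
    rw [metric, surface_toFun, conformalFactor_radialGraph hx, unitNormal, real_inner_smul_left,
      real_inner_smul_right, real_inner_self_eq_norm_sq]
    field_simp
  normal x hx v := by
    have hv := Submodule.mem_orthogonal_singleton_iff_inner_right.1 v.2
    have h : surface.differential x v = fderiv ℝ radialGraph x v := rfl
    rw [metric, h, fderiv_radialGraph hx, unitNormal, real_inner_smul_left, real_inner_smul_right,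
      inner_normalField_tangentVector hx hv]
    ring
  outward _ hx := eventually_mem_exterior hx

/-- The coefficient `a` is immaterial: the normal component disappears on pairing with a tangent
vector. -/
theorem fderiv_unitNormal {x : E 3} (hx : x ∈ Metric.sphere (0 : E 3) 1) (v : E 3) :
    ∃ a : ℝ, fderiv ℝ unitNormal x v =
      ((height x + 1) * ‖normalField x‖)⁻¹ • fderiv ℝ normalField x v + a • normalField x := by
  have hN : DifferentiableAt ℝ normalField x := contDiff_normalField.differentiable (by simp) x
  have he : DifferentiableAt ℝ (fun y => ((height y + 1) * ‖normalField y‖)⁻¹) x :=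
    (((contDiff_height.differentiable (by simp) x).add_const 1).mul
      (hN.norm ℝ (norm_pos_iff.1 (norm_normalField_pos hx)))).inv
      (mul_pos (height_add_one_pos hx) (norm_normalField_pos hx)).ne'
  have h : HasFDerivAt unitNormal _ x := he.hasFDerivAt.smul hN.hasFDerivAt
  rw [h.fderiv]
  exact ⟨_, rfl⟩

/-- The eigenvalue equation is paired with the tangent vector `W`. Of the Christoffel terms only a
nonnegative multiple of `‖W‖ ^ 2` survives, and it can be dropped. The remaining Euclidean part is
`1 / sinh r > 2` on the reference sphere, which leaves ample room for the crude bounds. -/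
theorem one_le_principalCurvature {x : E 3} (hx : x ∈ Metric.sphere (0 : E 3) 1) {κ : ℝ}
    (hκ : surface.IsPrincipalCurvature unitNormal x κ) : 1 ≤ κ := by
  obtain ⟨v, hv0, hv⟩ := hκ
  have hvx := Submodule.mem_orthogonal_singleton_iff_inner_right.1 v.2
  have hd : surface.differential x v = fderiv ℝ radialGraph x v := rfl
  have hh := height_add_one_pos hx
  have hs := height_sq_sub_one_pos hx
  have hN := norm_normalField_pos hx
  have hr := radius_pos hx
  have hN2 := norm_normalField_le hx
  obtain ⟨hs1, -⟩ := height_sq_sub_one_mem_Icc hx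
  set W := tangentVector x v with hW
  set e := ((height x + 1) * ‖normalField x‖)⁻¹ with he
  set b := radius x / (height x ^ 2 - 1) with hb
  have he0 : 0 < e := by positivity
  have hb0 : 0 < b := by positivity
  have hW0 : 0 < ‖W‖ := norm_pos_iff.2 (tangentVector_ne_zero hx hvx (by simpa using hv0))
  have hNW : ⟪normalField x, W⟫ = 0 := inner_normalField_tangentVector hx hvx
  obtain ⟨a, ha⟩ := fderiv_unitNormal hx (v : E 3)
  have key := congrArg (fun z => ⟪z, W⟫) hv
  simp only [EmbeddedSphere.covariantDeriv] at key
  rw [hd, fderiv_radialGraph hx, ha, surface_toFun, christoffel, conformalFactor_radialGraph hx,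
    ← hW, ← he, ← hb] at key
  have hξ : unitNormal x = e • normalField x := rfl
  have hp : ⟪radialGraph x, unitNormal x⟫ = radius x * (e * (height x ^ 2 - 1)) := by
    rw [radialGraph, hξ, real_inner_smul_left, real_inner_smul_right, inner_self_normalField hx]
  simp only [inner_add_left, inner_sub_left, real_inner_smul_left, hp] at key
  simp only [hξ, real_inner_smul_left, real_inner_smul_right, real_inner_comm (normalField x) W,
    hNW, real_inner_self_eq_norm_sq] at key
  have hlow := le_inner_fderiv_normalField hx hvx
  have hup := norm_sq_tangentVector_le hx hvx
  rw [← hW] at hlow hup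
  have hpos : 0 ≤ (height x + 1) * (radius x * (e * (height x ^ 2 - 1)) * (b * ‖W‖ ^ 2)) := by
    positivity
  have h1 : e * ⟪fderiv ℝ normalField x v, W⟫ ≤ κ * (b * ‖W‖ ^ 2) := by linarith
  have hv2 : 0 < ‖(v : E 3)‖ := norm_pos_iff.2 (by simpa using hv0)
  have h2 : b * ‖W‖ ^ 2 ≤ e * ⟪fderiv ℝ normalField x v, W⟫ := by
    -- The right side is `sinh r`, and `0.45 ^ 2 = 0.2025` is below the bound `0.2078` for `sinh²
    -- r`.
    have hrad : 0.45 ≤ (height x + 1) * radius x := by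
      refine le_of_sq_le_sq ?_ (by positivity)
      rw [mul_pow, height_add_one_mul_radius_sq hx]
      norm_num at hs1 ⊢
      linarith
    have h3 : b * ‖W‖ ^ 2 = e * (‖normalField x‖ * ((height x + 1) * b * ‖W‖ ^ 2)) := by
      rw [he]; field_simp
    have hb1 : (height x + 1) * b * ((height x + 1) * radius x) = 1 := by
      rw [hb]
      field_simp
      have := height_add_one_mul_radius_sq hx
      linarith
    rw [h3]
    gcongr
    refine le_trans ?_ hlow
    have h4 : (height x + 1) * b ≤ 1 / 0.45 := by
      rw [le_div_iff₀ (by norm_num)]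
      exact (mul_le_mul_of_nonneg_left hrad (by positivity)).trans hb1.le
    calc ‖normalField x‖ * ((height x + 1) * b * ‖W‖ ^ 2)
        ≤ 0.2125 * (1 / 0.45 * (((height x ^ 2 - 1) ^ 2 + (1 / 1000) ^ 2) * ‖(v : E 3)‖ ^ 2)) := by
          gcongr
      _ = (0.2125 / 0.45 * ((height x ^ 2 - 1) ^ 2 + (1 / 1000) ^ 2)) * ‖(v : E 3)‖ ^ 2 := by ring
      _ ≤ _ := by
          refine mul_le_mul_of_nonneg_right ?_ (by positivity)
          generalize height x ^ 2 - 1 = t at hs1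
          norm_num at hs1 ⊢
          nlinarith
  have h5 : 0 < b * ‖W‖ ^ 2 := by positivity
  exact le_of_mul_le_mul_right (by linarith) h5

theorem horosphericallyConvex_surface : surface.HorosphericallyConvex :=
  ⟨unitNormal, isOutwardUnitNormal_unitNormal, fun _ hx _ hκ => one_le_principalCurvature hx hκ⟩

/-! ### The area density -/

/-- The Gram matrix is `s (1 + c cᵀ)` with `s = height x ^ 2 - 1`, a rank-one perturbation of a
scalar matrix. In dimension `2` its determinant is `s² (1 + |c|²)`, and Parseval's identity
evaluates `|c|²`. -/
theorem areaDensity_surface {x : E 3} (hx : x ∈ Metric.sphere (0 : E 3) 1) :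
    surface.areaDensity x = ‖normalField x‖ := by
  have hs := height_sq_sub_one_pos hx
  have hrank : Module.finrank ℝ (sphereTangent x) = 2 := by
    have : Fact (Module.finrank ℝ (E 3) = 2 + 1) := ⟨by simp⟩
    have hx0 : x ≠ 0 := by
      rintro rfl
      simp at hx
    exact Submodule.finrank_orthogonal_span_singleton hx0
  set b := stdOrthonormalBasis ℝ (sphereTangent x) with hb
  let q : sphereTangent x := ⟨cubicTangentGrad x,
    Submodule.mem_orthogonal_singleton_iff_inner_right.2 (inner_cubicTangentGrad_self hx)⟩
  let c : Fin (Module.finrank ℝ (sphereTangent x)) → ℝ :=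
    fun i => ⟪q, b i⟫ / (1000 * (height x ^ 2 - 1))
  have hM : (Matrix.of fun i j => metric (surface.toFun x) (surface.differential x (b i))
      (surface.differential x (b j))) = (height x ^ 2 - 1) •
        (1 + Matrix.replicateCol Unit c * Matrix.replicateRow Unit c) := by
    ext i j
    have hd (v : sphereTangent x) : surface.differential x v = fderiv ℝ radialGraph x v := rfl
    have hv (k) := Submodule.mem_orthogonal_singleton_iff_inner_right.1 (b k).2
    have hg (k) : ⟪cubicGrad x, (b k : E 3)⟫ = ⟪q, b k⟫ :=
      (inner_cubicTangentGrad_eq (hv k)).symm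
    have hbb : ⟪(b i : E 3), (b j : E 3)⟫ = (1 : Matrix _ _ ℝ) i j := by
      rw [Matrix.one_apply]
      exact orthonormal_iff_ite.1 b.orthonormal i j
    have hhr := height_add_one_mul_radius_sq hx
    rw [Matrix.of_apply, metric, hd, hd, fderiv_radialGraph hx, fderiv_radialGraph hx,
      surface_toFun, conformalFactor_radialGraph hx, real_inner_smul_left, real_inner_smul_right,
      inner_tangentVector hx (hv i), hg, hg, hv j, hbb]
    simp only [Matrix.smul_apply, Matrix.add_apply, Matrix.mul_apply, Matrix.replicateCol_apply,
      Matrix.replicateRow_apply, Finset.univ_unique, Finset.sum_singleton, c, smul_eq_mul]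
    calc _ = ((height x + 1) ^ 2 * radius x ^ 2) * ((height x ^ 2 - 1)⁻¹ ^ 2 *
          ((height x ^ 2 - 1) ^ 2 * (1 : Matrix _ _ ℝ) i j
            + ⟪q, b i⟫ / 1000 * (⟪q, b j⟫ / 1000))) := by ring
      _ = _ := by
        rw [hhr]
        field_simp
  have hq : ∑ i, ⟪q, b i⟫ ^ 2 = ‖cubicTangentGrad x‖ ^ 2 := by
    exact b.sum_sq_inner_left q
  have hdet : Matrix.det (Matrix.of fun i j => metric (surface.toFun x)
      (surface.differential x (b i)) (surface.differential x (b j))) = ‖normalField x‖ ^ 2 := by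
    rw [hM, Matrix.det_smul, Matrix.det_one_add_replicateCol_mul_replicateRow,
      norm_sq_normalField hx, (Fintype.card_fin _).trans hrank, ← hq]
    have : c ⬝ᵥ c = (∑ i, ⟪q, b i⟫ ^ 2) / (1000 * (height x ^ 2 - 1)) ^ 2 := by
      simp only [dotProduct, c, Finset.sum_div]
      exact Finset.sum_congr rfl fun i _ => by rw [← sq, div_pow]
    rw [this]
    field_simp
  rw [EmbeddedSphere.areaDensity, hdet, Real.sqrt_sq (norm_nonneg _)]

/-! ### Isometry invariance and integrals of the harmonic -/

/-- The restriction of a linear isometry to the unit sphere. -/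
def sphereMap {F : Type*} [NormedAddCommGroup F] [InnerProductSpace ℝ F] (R : F ≃ₗᵢ[ℝ] F)
    (x : Metric.sphere (0 : F) 1) : Metric.sphere (0 : F) 1 :=
  ⟨R x, by simp⟩

theorem continuous_sphereMap {F : Type*} [NormedAddCommGroup F] [InnerProductSpace ℝ F]
    (R : F ≃ₗᵢ[ℝ] F) : Continuous (sphereMap R) :=
  (R.continuous.comp continuous_subtype_val).subtype_mk _

-- The measure of a subset of the sphere is a multiple of the volume of the cone over it; isometries
-- commute with forming cones and preserve volume.
open scoped Pointwise in
theorem measurePreserving_sphereMap {F : Type*} [NormedAddCommGroup F] [InnerProductSpace ℝ F]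
    [FiniteDimensional ℝ F] [MeasurableSpace F] [BorelSpace F] (R : F ≃ₗᵢ[ℝ] F) :
    MeasurePreserving (sphereMap R) (volume : Measure F).toSphere (volume : Measure F).toSphere := by
  have hm := (continuous_sphereMap R).measurable
  refine ⟨hm, Measure.ext fun s hs => ?_⟩
  rw [Measure.map_apply hm hs, Measure.toSphere_apply' _ hs, Measure.toSphere_apply' _ (hm hs)]
  congr 1
  have h : (R ⁻¹' (Ioo (0 : ℝ) 1 • (Subtype.val '' s))) =
      Ioo (0 : ℝ) 1 • (Subtype.val '' (sphereMap R ⁻¹' s)) := by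
    ext y
    simp only [mem_preimage, Set.mem_smul, mem_image]
    constructor
    · rintro ⟨r, hr, _, ⟨z, hz, rfl⟩, h⟩
      refine ⟨r, hr, _, ⟨sphereMap R.symm z, ?_, rfl⟩, ?_⟩
      · have : sphereMap R (sphereMap R.symm z) = z := Subtype.ext (R.apply_symm_apply _)
        rwa [this]
      · apply R.injective
        rw [← h, map_smul]
        exact congrArg _ (R.apply_symm_apply _)
    · rintro ⟨r, hr, _, ⟨z, hz, rfl⟩, rfl⟩
      exact ⟨r, hr, _, ⟨_, hz, rfl⟩, (map_smul R r (z : F)).symm⟩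
  rw [← h]
  exact R.measurePreserving.measure_preimage_equiv (f := R.toMeasurableEquiv) _

theorem integral_comp_sphereMap {n : ℕ} (R : E n ≃ₗᵢ[ℝ] E n) {g : E n → ℝ} (hg : Continuous g) :
    ∫ x : Metric.sphere (0 : E n) 1, g (R x) ∂(volume : Measure (E n)).toSphere =
      ∫ x : Metric.sphere (0 : E n) 1, g x ∂(volume : Measure (E n)).toSphere := by
  have h := measurePreserving_sphereMap R
  have h2 := integral_map (μ := (volume : Measure (E n)).toSphere) (φ := sphereMap R)
    h.measurable.aemeasurable (f := fun x => g x)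
    (hg.comp continuous_subtype_val).aestronglyMeasurable
  rw [h.map_eq] at h2
  exact h2.symm

/-- The uniform measure on the unit sphere of `ℝ³`. -/
abbrev sphereMeasure : Measure (Metric.sphere (0 : E 3) 1) := (volume : Measure (E 3)).toSphere

theorem integrable_sphere {g : E 3 → ℝ} (hg : Continuous g) :
    Integrable (fun x : Metric.sphere (0 : E 3) 1 => g x) sphereMeasure :=
  (hg.comp continuous_subtype_val).integrable_of_hasCompactSupport
    (HasCompactSupport.of_compactSpace _)

theorem cubic_neg (x : E 3) : cubic (-x) = -cubic x := by
  simp [cubic]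

theorem integral_cubic_pow_of_odd {k : ℕ} (hk : Odd k) :
    ∫ x : Metric.sphere (0 : E 3) 1, cubic x ^ k ∂sphereMeasure = 0 := by
  have h := integral_comp_sphereMap (LinearIsometryEquiv.neg ℝ) (g := fun x => cubic x ^ k)
    (contDiff_cubic.continuous.pow k)
  simp only [LinearIsometryEquiv.coe_neg, cubic_neg, hk.neg_pow, integral_neg] at h
  linarith

/-- The isometry `x ↦ ((xᵢ + xⱼ) / √2, (xᵢ - xⱼ) / √2, xₖ)`. -/
def diagonalIsometry (i j k : Fin 3) (h : ∀ x : E 3, x i ^ 2 + x j ^ 2 + x k ^ 2 = ‖x‖ ^ 2) :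
    E 3 →ₗᵢ[ℝ] E 3 where
  toFun x := !₂[(x i + x j) / √2, (x i - x j) / √2, x k]
  map_add' x y := by ext l; fin_cases l <;> simp <;> ring
  map_smul' t x := by ext l; fin_cases l <;> simp <;> ring
  norm_map' x := by
    refine (sq_eq_sq₀ (norm_nonneg _) (norm_nonneg _)).1 ?_
    rw [← h x, norm_sq_eq_sum_three]
    simp [div_pow]
    ring

theorem integral_diagonal (i j k : Fin 3)
    (h : ∀ x : E 3, x i ^ 2 + x j ^ 2 + x k ^ 2 = ‖x‖ ^ 2) :
    ∫ x : Metric.sphere (0 : E 3) 1, ((x.1 i ^ 2 - x.1 j ^ 2) * x.1 k / 2) ^ 2 ∂sphereMeasure =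
      ∫ x : Metric.sphere (0 : E 3) 1, cubic x ^ 2 ∂sphereMeasure := by
  rw [← integral_comp_sphereMap ((diagonalIsometry i j k h).toLinearIsometryEquiv rfl)
    (g := fun x => cubic x ^ 2) (contDiff_cubic.continuous.pow 2)]
  congr 1
  funext x
  have h2 : √2 * √2 = (2 : ℝ) := Real.mul_self_sqrt (by norm_num)
  have : cubic ((diagonalIsometry i j k h).toLinearIsometryEquiv rfl x) =
      (x.1 i + x.1 j) / √2 * ((x.1 i - x.1 j) / √2) * x.1 k := rfl
  rw [this, div_mul_div_comm, h2]
  ring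

theorem norm_sq_cubicTangentGrad_eq_sum {x : E 3} (hx : x ∈ Metric.sphere (0 : E 3) 1) :
    ‖cubicTangentGrad x‖ ^ 2 = 4 * (((x 0 ^ 2 - x 1 ^ 2) * x 2 / 2) ^ 2
      + ((x 1 ^ 2 - x 2 ^ 2) * x 0 / 2) ^ 2 + ((x 2 ^ 2 - x 0 ^ 2) * x 1 / 2) ^ 2) := by
  have h := sum_sq_of_mem_sphere hx
  rw [norm_sq_cubicTangentGrad hx, norm_sq_eq_sum_three]
  simp [cubicGrad, cubic]
  linear_combination (-(x 1 * x 2) ^ 2 - (x 0 * x 2) ^ 2 - (x 0 * x 1) ^ 2) * h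

/-- The eigenvalue `12` of the spherical Laplacian, obtained without integrating by parts: `|∇u|²`
is `4` times a sum of three squares, each the pullback of `cubic ^ 2` by one of the isometries
`diagonalIsometry`. -/
theorem integral_norm_sq_cubicTangentGrad :
    ∫ x : Metric.sphere (0 : E 3) 1, ‖cubicTangentGrad x‖ ^ 2 ∂sphereMeasure =
      12 * ∫ x : Metric.sphere (0 : E 3) 1, cubic x ^ 2 ∂sphereMeasure := by
  have hi (i j k : Fin 3) : Integrable (fun x : Metric.sphere (0 : E 3) 1 =>
      ((x.1 i ^ 2 - x.1 j ^ 2) * x.1 k / 2) ^ 2) sphereMeasure :=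
    integrable_sphere (g := fun x => ((x i ^ 2 - x j ^ 2) * x k / 2) ^ 2) (by fun_prop)
  simp_rw [fun x : Metric.sphere (0 : E 3) 1 => norm_sq_cubicTangentGrad_eq_sum x.2]
  rw [integral_const_mul, integral_add (by exact (hi 0 1 2).add (hi 1 2 0)) (hi 2 0 1),
    integral_add (hi 0 1 2) (hi 1 2 0), integral_diagonal, integral_diagonal, integral_diagonal]
  · ring
  all_goals intro x; linarith [norm_sq_eq_sum_three x]

theorem integral_cubic_sq_pos :
    0 < ∫ x : Metric.sphere (0 : E 3) 1, cubic x ^ 2 ∂sphereMeasure := by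
  have hc : Continuous fun x : Metric.sphere (0 : E 3) 1 => cubic x ^ 2 :=
    (contDiff_cubic.continuous.pow 2).comp continuous_subtype_val
  let y : E 3 := !₂[1, 1, 1]
  have hy : 0 < ‖y‖ := norm_pos_iff.2 fun h => by simpa [y] using congrArg (fun z : E 3 => z 0) h
  have hy1 : ‖y‖⁻¹ • y ∈ Metric.sphere (0 : E 3) 1 := by
    rw [mem_sphere_zero_iff_norm, norm_smul, norm_inv, norm_norm, inv_mul_cancel₀ hy.ne']
  refine hc.integral_pos_of_hasCompactSupport_nonneg_nonzero
    (HasCompactSupport.of_compactSpace _) (fun x => sq_nonneg _) (x := ⟨_, hy1⟩) ?_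
  have : cubic (‖y‖⁻¹ • y) = ‖y‖⁻¹ ^ 3 := by
    rw [cubic_smul]; simp [cubic, y]
  simp [this, hy.ne']

/-! ### Expansion of the area and of the weighted area -/

/-- The excess of the area density over that of the geodesic sphere through the same point. -/
def densityExcess (x : E 3) : ℝ := ‖normalField x‖ - (height x ^ 2 - 1)

theorem continuous_densityExcess : Continuous densityExcess :=
  contDiff_normalField.continuous.norm.sub
    ((contDiff_height.continuous.pow 2).sub continuous_const)

theorem densityExcess_nonneg {x : E 3} (hx : x ∈ Metric.sphere (0 : E 3) 1) :
    0 ≤ densityExcess x :=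
  sub_nonneg.2 (height_sq_sub_one_le_norm_normalField hx)

/-- A difference of squares: the left side is the excess times `‖normalField x‖ + (height x ^ 2 -
1)`, and this sum is at most `0.2125 + 0.2123`. -/
theorem norm_sq_cubicTangentGrad_le_densityExcess {x : E 3}
    (hx : x ∈ Metric.sphere (0 : E 3) 1) :
    (1 / 1000) ^ 2 * ‖cubicTangentGrad x‖ ^ 2 ≤ 0.4255 * densityExcess x := by
  have h1 := norm_sq_normalField hx
  have h2 := norm_normalField_le hx
  have h3 := (height_sq_sub_one_mem_Icc hx).2
  have h4 := densityExcess_nonneg hx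
  have h5 : (1 / 1000) ^ 2 * ‖cubicTangentGrad x‖ ^ 2 =
      (‖normalField x‖ + (height x ^ 2 - 1)) * densityExcess x := by
    rw [densityExcess]; linarith
  rw [h5]
  gcongr
  norm_num at h2 h3 ⊢
  linarith

theorem integral_norm_sq_cubicTangentGrad_le :
    12 * (1 / 1000) ^ 2 * ∫ x : Metric.sphere (0 : E 3) 1, cubic x ^ 2 ∂sphereMeasure ≤
      0.4255 * ∫ x : Metric.sphere (0 : E 3) 1, densityExcess x ∂sphereMeasure := by
  calc _ = ∫ x : Metric.sphere (0 : E 3) 1, (1 / 1000) ^ 2 * ‖cubicTangentGrad x‖ ^ 2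
          ∂sphereMeasure := by
        rw [integral_const_mul, integral_norm_sq_cubicTangentGrad]; ring
    _ ≤ ∫ x : Metric.sphere (0 : E 3) 1, 0.4255 * densityExcess x ∂sphereMeasure :=
        integral_mono
          (integrable_sphere (g := fun x => (1 / 1000) ^ 2 * ‖cubicTangentGrad x‖ ^ 2)
            (continuous_const.mul (contDiff_cubicTangentGrad.continuous.norm.pow 2)))
          (integrable_sphere (g := fun x => 0.4255 * densityExcess x)
            (continuous_const.mul continuous_densityExcess))
          fun x => norm_sq_cubicTangentGrad_le_densityExcess x.2
    _ = _ := integral_const_mul _ _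

theorem surfaceIntegral_surface (f : E 3 → ℝ) : surface.surfaceIntegral f =
    ∫ x : Metric.sphere (0 : E 3) 1, f (radialGraph x) * ‖normalField x‖ ∂sphereMeasure := by
  unfold EmbeddedSphere.surfaceIntegral
  congr 1
  funext x
  rw [areaDensity_surface x.2, surface_toFun]

theorem integral_cubic : ∫ x : Metric.sphere (0 : E 3) 1, cubic x ∂sphereMeasure = 0 := by
  simpa using integral_cubic_pow_of_odd odd_one

theorem area_surface : surface.area = 0.21 * unitSphereArea 3
    + (1 / 1000) ^ 2 * (∫ x : Metric.sphere (0 : E 3) 1, cubic x ^ 2 ∂sphereMeasure)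
    + ∫ x : Metric.sphere (0 : E 3) 1, densityExcess x ∂sphereMeasure := by
  have h1 := integrable_sphere contDiff_cubic.continuous
  have h2 := integrable_sphere (g := fun x => cubic x ^ 2) (contDiff_cubic.continuous.pow 2)
  have h3 := integrable_sphere continuous_densityExcess
  have h (x : Metric.sphere (0 : E 3) 1) : 1 * ‖normalField x‖ =
      0.21 + 2.2 / 1000 * cubic x + (1 / 1000) ^ 2 * cubic x ^ 2 + densityExcess x := by
    rw [densityExcess, height]; ring
  rw [EmbeddedSphere.area, surfaceIntegral_surface]
  simp_rw [h]
  rw [integral_add (by exact ((integrable_const _).add (h1.const_mul _)).add (h2.const_mul _)) h3,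
    integral_add (by exact (integrable_const _).add (h1.const_mul _)) (h2.const_mul _),
    integral_add (integrable_const _) (h1.const_mul _), integral_const_mul, integral_const_mul,
    integral_cubic, integral_const, unitSphereArea, smul_eq_mul]
  ring

theorem surfaceIntegral_rho_surface : surface.surfaceIntegral rho = 1.1 * surface.area
    + 2.2 * (1 / 1000) ^ 2 * (∫ x : Metric.sphere (0 : E 3) 1, cubic x ^ 2 ∂sphereMeasure)
    + 1 / 1000 * ∫ x : Metric.sphere (0 : E 3) 1, cubic x * densityExcess x ∂sphereMeasure := by
  have h0 := integrable_sphere contDiff_normalField.continuous.norm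
  have h1 := integrable_sphere contDiff_cubic.continuous
  have h2 := integrable_sphere (g := fun x => cubic x ^ 2) (contDiff_cubic.continuous.pow 2)
  have h3 := integrable_sphere (g := fun x => cubic x ^ 3) (contDiff_cubic.continuous.pow 3)
  have h4 := integrable_sphere (g := fun x => cubic x * densityExcess x)
    (contDiff_cubic.continuous.mul continuous_densityExcess)
  have h (x : Metric.sphere (0 : E 3) 1) : rho (radialGraph x) * ‖normalField x‖ =
      1.1 * ‖normalField x‖ + 0.21 / 1000 * cubic x + 2.2 * (1 / 1000) ^ 2 * cubic x ^ 2
        + (1 / 1000) ^ 3 * cubic x ^ 3 + 1 / 1000 * (cubic x * densityExcess x) := by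
    rw [rho_radialGraph x.2, densityExcess, height]; ring
  rw [EmbeddedSphere.area, surfaceIntegral_surface, surfaceIntegral_surface]
  simp_rw [h, one_mul]
  rw [integral_add (by
      exact (((h0.const_mul _).add (h1.const_mul _)).add (h2.const_mul _)).add (h3.const_mul _))
      (h4.const_mul _),
    integral_add (by exact ((h0.const_mul _).add (h1.const_mul _)).add (h2.const_mul _))
      (h3.const_mul _),
    integral_add (by exact (h0.const_mul _).add (h1.const_mul _)) (h2.const_mul _),
    integral_add (h0.const_mul _) (h1.const_mul _), integral_const_mul, integral_const_mul,
    integral_const_mul, integral_const_mul, integral_const_mul, integral_cubic,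
    integral_cubic_pow_of_odd (k := 3) (by decide)]
  ring

theorem integral_cubic_mul_densityExcess_le :
    ∫ x : Metric.sphere (0 : E 3) 1, cubic x * densityExcess x ∂sphereMeasure ≤
      ∫ x : Metric.sphere (0 : E 3) 1, densityExcess x ∂sphereMeasure :=
  integral_mono (integrable_sphere (g := fun x => cubic x * densityExcess x)
      (contDiff_cubic.continuous.mul continuous_densityExcess))
    (integrable_sphere continuous_densityExcess) fun x =>
      mul_le_of_le_one_left (densityExcess_nonneg x.2) (abs_le.1 (abs_cubic_le_one x.2)).2

theorem integral_cubic_sq_le :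
    ∫ x : Metric.sphere (0 : E 3) 1, cubic x ^ 2 ∂sphereMeasure ≤ unitSphereArea 3 := by
  have h := integral_mono (μ := sphereMeasure)
    (integrable_sphere (g := fun x => cubic x ^ 2) (contDiff_cubic.continuous.pow 2))
    (integrable_const (1 : ℝ)) fun x => (sq_le_one_iff_abs_le_one _).2 (abs_cubic_le_one x.2)
  simpa [unitSphereArea] using h

theorem surfaceIntegral_rho_surface_nonneg : 0 ≤ surface.surfaceIntegral rho := by
  rw [surfaceIntegral_surface]
  refine integral_nonneg fun x => mul_nonneg ?_ (norm_nonneg _)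
  rw [rho_radialGraph x.2]
  exact (zero_lt_one.trans (one_lt_height x.2)).le

/-! ### The final numerical inequality -/

/-- After squaring, the claim is `J² W < A³ + A² W`. Since `1.1² = 1 + 0.21`, the zeroth-order terms
cancel and only the second-order quantities `M` and `B` are compared. -/
theorem lt_mul_rpow_of_density_bounds {W M A B J : ℝ} (hM : 0 < M) (hMW : M ≤ W)
    (hA : A = 0.21 * W + (1 / 1000) ^ 2 * M + B)
    (hB : 12 * (1 / 1000) ^ 2 * M ≤ 0.4255 * B)
    (hJ0 : 0 ≤ J) (hJ : J ≤ 1.1 * A + 2.2 * (1 / 1000) ^ 2 * M + 1 / 1000 * B) :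
    J < W * ((A / W) ^ 3 + (A / W) ^ 2) ^ (1 / 2 : ℝ) := by
  have hW : 0 < W := hM.trans_le hMW
  norm_num at hA hB hJ
  have hB0 : 0 < B := by linarith
  have hAW : 21 / 100 * W ≤ A := by linarith
  have hA0 : 0 < A := by linarith
  obtain ⟨D, hD⟩ : ∃ D, D = 11 / 5000000 * M + 1 / 1000 * B := ⟨_, rfl⟩
  have hD0 : 0 < D := by rw [hD]; positivity
  have hDA : D ≤ 1 / 100 * A := by linarith
  have hJD : J ≤ 11 / 10 * A + D := by linarith
  -- The cross term contributes `2.2`; the extra `0.01` absorbs `D ^ 2`.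
  have h1 : J ^ 2 ≤ 121 / 100 * A ^ 2 + 221 / 100 * (A * D) := by
    have := pow_le_pow_left₀ hJ0 hJD 2
    nlinarith [mul_le_mul_of_nonneg_right hDA hD0.le]
  have h2 : 221 / 100 * (D * W) < A * (1 / 1000000 * M + B) := by
    -- The decisive comparison, where the eigenvalue `12` enters: `hB` gives `B ≥ 28 ε² M`, so `0.21
    -- B` outweighs the roughly `4.9 ε² M` in `2.21 D`.
    have h3 : 221 / 100 * D < 21 / 100 * (1 / 1000000 * M + B) := by linarith
    have h4 := mul_lt_mul_of_pos_right h3 hW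
    have h5 : 0 ≤ 1 / 1000000 * M + B := by positivity
    nlinarith [mul_le_mul_of_nonneg_right hAW h5]
  have h3 : J ^ 2 * W < A ^ 3 + A ^ 2 * W := by
    have h4 := mul_le_mul_of_nonneg_right h1 hW.le
    have h5 := mul_lt_mul_of_pos_left h2 hA0
    have h6 : A ^ 3 = A ^ 2 * (21 / 100 * W + 1 / 1000000 * M + B) := by rw [← hA]; ring
    rw [h6]
    linarith
  rw [← Real.sqrt_eq_rpow, mul_comm, ← div_lt_iff₀ hW, Real.lt_sqrt (by positivity)]
  have h4 : (A / W) ^ 3 + (A / W) ^ 2 = (A ^ 3 + A ^ 2 * W) / W ^ 3 := by field_simp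
  have h5 : (J / W) ^ 2 = J ^ 2 * W / W ^ 3 := by field_simp
  rw [h4, h5]
  gcongr

end PoincareBall

end

theorem theorem1 :
    ∃ Γ : PoincareBall.EmbeddedSphere 3, Γ.HorosphericallyConvex ∧
      Γ.surfaceIntegral PoincareBall.rho <
        PoincareBall.unitSphereArea 3 *
          ((Γ.area / PoincareBall.unitSphereArea 3) ^ 3 +
            (Γ.area / PoincareBall.unitSphereArea 3) ^ 2) ^ (1 / 2 : ℝ) := by
  refine ⟨PoincareBall.surface, PoincareBall.horosphericallyConvex_surface,
    PoincareBall.lt_mul_rpow_of_density_bounds PoincareBall.integral_cubic_sq_pos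
      PoincareBall.integral_cubic_sq_le PoincareBall.area_surface
      PoincareBall.integral_norm_sq_cubicTangentGrad_le
      PoincareBall.surfaceIntegral_rho_surface_nonneg ?_⟩
  rw [PoincareBall.surfaceIntegral_rho_surface]
  linarith [PoincareBall.integral_cubic_mul_densityExcess_le]
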